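/- Let $\mathcal R$ be the Levi-Civita field: the set of functions $f:\mathbb Q\to\mathbb R$ whose support has only finitely many elements below any given rational, with pointwise addition and convolution as multiplication, ordered by declaring $f\neq 0$ positive iff its value at the least element of its support is positive, and equipped with the order topology. Let $\tau\in\mathcal R$ be the function with $\tau(1)=1$ and $\tau(q)=0$ for $q\ne 1$. For $m\in\mathbb Z$ write $o(\tau^m)$ for an element of the form $\sum_{k\ge m+1}a_k\tau^k$ ($k\in\mathbb Z$, $a_k\in\mathbb R$). A network $\Gamma=(V,\rho,a_0,B)$ over an ordered field $K$ consists of a locally finite connected graph on a vertex set $V$ with $|V|\ge 2$, a symmetric function $\rho:V\times V\to K$ (the admittance) that is positive on edges and zero on all other pairs, a vertex $a_0$, and a non-empty set $B\subseteq V\setminus\{a_0\}$. If $\Gamma$ is finite, its effective admittance is $\mathcal P_{\mathrm{eff}}(\Gamma)=\sum_{x\sim a_0}(1-v(x))\rho_{xa_0}$, where $v:V\to K$ is the solution of the Dirichlet problem $\sum_y (v(y)-v(x))\rho_{xy}=0$ for $x\notin B\cup\{a_0\}$, $v=0$ on $B$, $v(a_0)=1$. If $\Gamma$ is infinite, it is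 exhausted by the finite networks $\Gamma_n=(V_n,\rho|_{V_n},a_0,(B\cap V_n)\cup\partial V_n)$, $n\ge 1$, where $V_n=\{x:\operatorname{dist}(a_0,x)\le n\}$ and $\partial V_n=\{x:\operatorname{dist}(a_0,x)=n\}$. Let $L,C>0$ be real numbers and put $\alpha=C\tau^{-1}$, $\beta=L^{-1}\tau$. Let $\Gamma$ be the $CL$-ladder network over $\mathcal R$: its vertices are $a_0,a_1,a_2,\dots,x_1,x_2,\dots$, its admittances are $\rho_{a_0x_1}=\alpha$, $\rho_{x_ix_{i+1}}=\alpha$ and $\rho_{a_ix_i}=\beta$ for $i\ge1$, and $\rho_{xy}=0$ for all other pairs, and $B=\{a_1,a_2,\dots\}$. Let $\Gamma_n$, $n\ge1$, be the finite networks exhausting $\Gamma$. Then, for every $n\ge 1$, the Dirichlet problem on $\Gamma_n$ has a unique solution, and the sequence $\{\mathcal P_{\mathrm{eff}}(\Gamma_n)\}_{n\ge1}$ does not converge in $\mathcal R$. More precisely, for every $n\ge1$, $$\mathcal P_{\mathrm{eff}}(\Gamma_{n+1})-\mathcal P_{\mathrm{eff}}(\Gamma_n)=-\frac{C}{n(n+1)}\,\tau^{-1}+o(\tau^{-1}),\qquad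 \left|\mathcal P_{\mathrm{eff}}(\Gamma_{n+1})-\mathcal P_{\mathrm{eff}}(\Gamma_n)\right|>\tau,$$ so that the sequence is not a Cauchy sequence in $\mathcal R$. -/

import Mathlib

/-! ### Networks over an ordered field -/

/-- A network `(V, ρ, a₀, B)` over an ordered field `K`: a locally finite connected graph with at
least two vertices, a positive admittance on the edges (extended by `0` to all pairs of vertices),
a vertex `a₀` and a non-empty set `B` of vertices not containing `a₀`. -/
structure Network (K : Type*) [Field K] [LinearOrder K] [IsStrictOrderedRing K] (V : Type*) where
  graph : SimpleGraph V
  nontrivial : Nontrivial V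
  locallyFinite : ∀ x, (graph.neighborSet x).Finite
  connected : graph.Connected
  ρ : V → V → K
  ρ_symm : ∀ x y, ρ x y = ρ y x
  ρ_pos : ∀ x y, graph.Adj x y → 0 < ρ x y
  ρ_eq_zero : ∀ x y, ¬ graph.Adj x y → ρ x y = 0
  a₀ : V
  B : Set V
  B_nonempty : B.Nonempty
  a₀_notMem : a₀ ∉ B

namespace Network

variable {K : Type*} [Field K] [LinearOrder K] [IsStrictOrderedRing K] {V : Type*}

/-- `Δ_ρ v (x) = ∑_y (v(y) - v(x)) ρ_{xy}`; only the finitely many neighbours of `x` contribute. -/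
noncomputable def laplacian (Γ : Network K V) (v : V → K) (x : V) : K :=
  ∑ᶠ y, (v y - v x) * Γ.ρ x y

/-- `v` solves the Dirichlet problem: `Δ_ρ v = 0` off `B ∪ {a₀}`, `v = 0` on `B`, `v(a₀) = 1`. -/
def IsDirichletSolution (Γ : Network K V) (v : V → K) : Prop :=
  (∀ x, x ∉ Γ.B → x ≠ Γ.a₀ → Γ.laplacian v x = 0) ∧ (∀ x ∈ Γ.B, v x = 0) ∧ v Γ.a₀ = 1

/-- The solution of the Dirichlet problem (an arbitrary function if there is none). -/
noncomputable def dirichletSolution (Γ : Network K V) : V → K :=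
  Classical.epsilon Γ.IsDirichletSolution

/-- The effective admittance `∑_{x ∼ a₀} (1 - v(x)) ρ_{x a₀}`, `v` the Dirichlet solution. -/
noncomputable def effectiveAdmittance (Γ : Network K V) : K :=
  ∑ᶠ x, (1 - Γ.dirichletSolution x) * Γ.ρ x Γ.a₀

/-- `V_n = {x | dist(a₀, x) ≤ n}`. -/
def distBall (Γ : Network K V) (n : ℕ) : Set V := {x | Γ.graph.dist Γ.a₀ x ≤ n}

theorem a₀_mem_distBall (Γ : Network K V) (n : ℕ) : Γ.a₀ ∈ Γ.distBall n := by
  simp [distBall]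

/-- A vertex at distance `n + 1` from `a₀` has a neighbour at distance `n`. -/
theorem exists_adj_dist (Γ : Network K V) {n : ℕ} {x : V} (hx : Γ.graph.dist Γ.a₀ x = n + 1) :
    ∃ y, Γ.graph.Adj y x ∧ Γ.graph.dist Γ.a₀ y = n := by
  obtain ⟨p, hp⟩ := Γ.connected.exists_walk_length_eq_dist x Γ.a₀
  rw [SimpleGraph.dist_comm, hx] at hp
  cases p with
  | nil => simp at hp
  | @cons _ y _ h q =>
    refine ⟨y, h.symm, ?_⟩
    have h1 : Γ.graph.dist Γ.a₀ y ≤ n := by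
      rw [SimpleGraph.dist_comm]
      refine (SimpleGraph.dist_le q).trans ?_
      simp only [SimpleGraph.Walk.length_cons] at hp
      omega
    have h2 := Γ.connected.dist_triangle (u := Γ.a₀) (v := y) (w := x)
    have h3 : Γ.graph.dist y x = 1 := SimpleGraph.dist_eq_one_iff_adj.mpr h.symm
    omega

theorem finite_distBall (Γ : Network K V) (n : ℕ) : (Γ.distBall n).Finite := by
  induction n with
  | zero =>
    refine (Set.finite_singleton Γ.a₀).subset fun x hx => ?_
    have hx : Γ.graph.dist Γ.a₀ x ≤ 0 := hx
    exact (Γ.connected.dist_eq_zero_iff.mp (Nat.le_zero.mp hx)).symm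
  | succ n ih =>
    refine (ih.union (ih.biUnion fun y _ => Γ.locallyFinite y)).subset fun x hx => ?_
    have hx : Γ.graph.dist Γ.a₀ x ≤ n + 1 := hx
    rcases Nat.lt_or_ge (Γ.graph.dist Γ.a₀ x) (n + 1) with h | h
    · exact Or.inl (Nat.lt_succ_iff.mp h)
    · obtain ⟨y, hy, hd⟩ := Γ.exists_adj_dist (le_antisymm hx h)
      exact Or.inr (Set.mem_biUnion (show y ∈ Γ.distBall n from hd.le) hy)

theorem exists_dist_eq (Γ : Network K V) [Infinite V] (n : ℕ) :
    ∃ x, Γ.graph.dist Γ.a₀ x = n := by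
  have hdown : ∀ k x, Γ.graph.dist Γ.a₀ x = n + k → ∃ y, Γ.graph.dist Γ.a₀ y = n := by
    intro k
    induction k with
    | zero => exact fun x hx => ⟨x, hx⟩
    | succ k ih =>
      intro x hx
      obtain ⟨y, -, hy⟩ := Γ.exists_adj_dist (n := n + k) hx
      exact ih y hy
  obtain ⟨x, hx⟩ := (Γ.finite_distBall n).infinite_compl.nonempty
  have hx : ¬ Γ.graph.dist Γ.a₀ x ≤ n := hx
  exact hdown (Γ.graph.dist Γ.a₀ x - n) x (by omega)

theorem connected_induce_distBall (Γ : Network K V) (n : ℕ) :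
    (Γ.graph.induce (Γ.distBall n)).Connected := by
  have key : ∀ k (x : Γ.distBall n), Γ.graph.dist Γ.a₀ x = k →
      (Γ.graph.induce (Γ.distBall n)).Reachable ⟨Γ.a₀, Γ.a₀_mem_distBall n⟩ x := by
    intro k
    induction k with
    | zero =>
      intro x hx
      have : Γ.a₀ = x := Γ.connected.dist_eq_zero_iff.mp hx
      have : (⟨Γ.a₀, Γ.a₀_mem_distBall n⟩ : Γ.distBall n) = x := Subtype.ext this
      rw [this]
    | succ k ih =>
      intro x hx
      obtain ⟨y, hy, hd⟩ := Γ.exists_adj_dist hx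
      have hxn : Γ.graph.dist Γ.a₀ x ≤ n := x.2
      have hyn : y ∈ Γ.distBall n := show Γ.graph.dist Γ.a₀ y ≤ n by omega
      refine (ih ⟨y, hyn⟩ hd).trans (SimpleGraph.Adj.reachable ?_)
      simpa using hy
  have : Nonempty (Γ.distBall n) := ⟨⟨Γ.a₀, Γ.a₀_mem_distBall n⟩⟩
  exact ⟨fun x y => (key _ x rfl).symm.trans (key _ y rfl)⟩

/-- The `n`-th finite network `Γ_n = (V_n, ρ|_{V_n}, a₀, (B ∩ V_n) ∪ ∂V_n)`, `n ≥ 1`, of the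
sequence exhausting the infinite network `Γ`, where `∂V_n = {x | dist(a₀, x) = n}`. -/
def exhaustion (Γ : Network K V) [Infinite V] (n : ℕ) (hn : n ≠ 0) :
    Network K (Γ.distBall n) where
  graph := Γ.graph.induce (Γ.distBall n)
  nontrivial := by
    obtain ⟨x, hx⟩ := Γ.exists_dist_eq n
    refine ⟨⟨Γ.a₀, Γ.a₀_mem_distBall n⟩, ⟨x, hx.le⟩, fun h => hn ?_⟩
    have h : Γ.a₀ = x := congrArg Subtype.val h
    rw [← hx, ← h, SimpleGraph.dist_self]
  locallyFinite := fun x =>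
    ((Γ.locallyFinite x).preimage Subtype.val_injective.injOn).subset fun y hy => by simpa using hy
  connected := Γ.connected_induce_distBall n
  ρ := fun x y => Γ.ρ x y
  ρ_symm := fun x y => Γ.ρ_symm x y
  ρ_pos := fun x y h => Γ.ρ_pos x y (by simpa using h)
  ρ_eq_zero := fun x y h => Γ.ρ_eq_zero x y (by simpa using h)
  a₀ := ⟨Γ.a₀, Γ.a₀_mem_distBall n⟩
  B := {x | (x : V) ∈ Γ.B ∨ Γ.graph.dist Γ.a₀ x = n}
  B_nonempty := by
    obtain ⟨x, hx⟩ := Γ.exists_dist_eq n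
    exact ⟨⟨x, hx.le⟩, Or.inr hx⟩
  a₀_notMem := by
    rintro (h | h)
    · exact Γ.a₀_notMem h
    · exact hn (by rw [← h, SimpleGraph.dist_self])

end Network

/-! ### The `αβ`-ladder -/

/-- The vertices of the ladder: `a i` is `a_i` (`i ≥ 0`), and `x i` is `x_{i+1}`. -/
inductive LadderVertex : Type
  | a : ℕ → LadderVertex
  | x : ℕ → LadderVertex

namespace LadderVertex

instance : Infinite LadderVertex :=
  Infinite.of_injective LadderVertex.a fun _ _ h => by injection h

variable {K : Type*} [Field K]

/-- `ρ_{a₀ x₁} = α`, `ρ_{x_i x_{i+1}} = α`, `ρ_{a_i x_i} = β` for `i ≥ 1`, symmetric, and `0`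
for all other pairs. -/
def admittance (α β : K) : LadderVertex → LadderVertex → K
  | a 0, x j => if j = 0 then α else 0
  | x j, a 0 => if j = 0 then α else 0
  | a (i + 1), x j => if i = j then β else 0
  | x j, a (i + 1) => if i = j then β else 0
  | x i, x j => if j = i + 1 ∨ i = j + 1 then α else 0
  | a _, a _ => 0

theorem admittance_symm (α β : K) (u v : LadderVertex) :
    admittance α β u v = admittance α β v u := by
  rcases u with (_ | i) | i <;> rcases v with (_ | j) | j <;> simp [admittance, or_comm]

theorem admittance_self (α β : K) (u : LadderVertex) : admittance α β u u = 0 := by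
  rcases u with (_ | i) | i <;> simp [admittance]

theorem admittance_nonneg [LinearOrder K] {α β : K} (hα : 0 < α) (hβ : 0 < β) (u v : LadderVertex) :
    0 ≤ admittance α β u v := by
  rcases u with (_ | i) | i <;> rcases v with (_ | j) | j <;> simp only [admittance] <;>
    first | exact le_rfl | (split_ifs <;> first | exact le_rfl | exact hα.le | exact hβ.le)

/-- The ladder graph: two vertices are joined by an edge iff the admittance of the pair is not
`0`. -/
def ladderGraph (α β : K) : SimpleGraph LadderVertex where
  Adj u v := admittance α β u v ≠ 0
  symm := ⟨fun u v h => by rwa [admittance_symm]⟩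
  loopless := ⟨fun u h => h (admittance_self α β u)⟩

theorem ladderGraph_connected [LinearOrder K] {α β : K} (hα : 0 < α) (hβ : 0 < β) :
    (ladderGraph α β).Connected := by
  have hx : ∀ i, (ladderGraph α β).Reachable (a 0) (x i) := by
    intro i
    induction i with
    | zero =>
      exact SimpleGraph.Adj.reachable
        (show admittance α β (a 0) (x 0) ≠ 0 by simpa [admittance] using hα.ne')
    | succ i ih =>
      exact ih.trans (SimpleGraph.Adj.reachable
        (show admittance α β (x i) (x (i + 1)) ≠ 0 by simpa [admittance] using hα.ne'))
  have h : ∀ u, (ladderGraph α β).Reachable (a 0) u := by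
    rintro ((_ | i) | i)
    · exact SimpleGraph.Reachable.refl _
    · exact (hx i).trans (SimpleGraph.Adj.reachable
        (show admittance α β (x i) (a (i + 1)) ≠ 0 by simpa [admittance] using hβ.ne'))
    · exact hx i
  have : Nonempty LadderVertex := ⟨a 0⟩
  exact ⟨fun u v => (h u).symm.trans (h v)⟩

theorem ladderGraph_locallyFinite (α β : K) (u : LadderVertex) :
    ((ladderGraph α β).neighborSet u).Finite := by
  have key : ∀ v, admittance α β u v ≠ 0 →
      v ∈ (match u with
        | a i => {x i, x (i - 1)}
        | x i => {a 0, a (i + 1), x (i + 1), x (i - 1)} : Set LadderVertex) := by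
    intro v hv
    rcases u with (_ | i) | i <;> rcases v with (_ | j) | j <;> simp [admittance] at hv ⊢ <;> omega
  refine Set.Finite.subset ?_ key
  rcases u with i | i <;> simp

/-- The infinite ladder network with series admittance `α` and shunt admittance `β`; the vertices
`a₁, a₂, …` are grounded. -/
def ladder [LinearOrder K] [IsStrictOrderedRing K] (α β : K) (hα : 0 < α) (hβ : 0 < β) : Network K LadderVertex where
  graph := ladderGraph α β
  nontrivial := inferInstance
  locallyFinite := ladderGraph_locallyFinite α β
  connected := ladderGraph_connected hα hβ
  ρ := admittance α β
  ρ_symm := admittance_symm α β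
  ρ_pos := fun u v h => lt_of_le_of_ne (admittance_nonneg hα hβ u v) (Ne.symm h)
  ρ_eq_zero := fun _ _ h => not_not.mp h
  a₀ := a 0
  B := {u | ∃ i, u = a (i + 1)}
  B_nonempty := ⟨a 1, 0, rfl⟩
  a₀_notMem := by simp

end LadderVertex

/-! ### The Levi-Civita field -/

/-- A set of rationals is left-finite if it has only finitely many elements below any rational. -/
def LeftFinite (M : Set ℚ) : Prop := ∀ r : ℚ, {q | q ∈ M ∧ q < r}.Finite

namespace LeftFinite

theorem mono {M N : Set ℚ} (hN : LeftFinite N) (h : M ⊆ N) : LeftFinite M := fun r =>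
  (hN r).subset fun _ hq => ⟨h hq.1, hq.2⟩

theorem union {M N : Set ℚ} (hM : LeftFinite M) (hN : LeftFinite N) : LeftFinite (M ∪ N) :=
  fun r => ((hM r).union (hN r)).subset fun _ hq => hq.1.imp (fun h => ⟨h, hq.2⟩) fun h => ⟨h, hq.2⟩

theorem singleton (q : ℚ) : LeftFinite {q} := fun _ =>
  (Set.finite_singleton q).subset fun _ h => h.1

theorem add {f g : HahnSeries ℚ ℝ} (hf : LeftFinite f.support) (hg : LeftFinite g.support) :
    LeftFinite (f + g).support :=
  (hf.union hg).mono (HahnSeries.support_add_subset _ _)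

theorem mul {f g : HahnSeries ℚ ℝ} (hf : LeftFinite f.support) (hg : LeftFinite g.support) :
    LeftFinite (f * g).support := by
  intro r
  refine ((hf (r - g.order)).add (hg (r - f.order))).subset ?_
  rintro q ⟨hq, hqr⟩
  obtain ⟨i, hi, j, hj, rfl⟩ := HahnSeries.support_mul_subset hq
  have h1 : f.order ≤ i := HahnSeries.order_le_of_coeff_ne_zero hi
  have h2 : g.order ≤ j := HahnSeries.order_le_of_coeff_ne_zero hj
  simp only at hqr
  exact ⟨i, ⟨hi, by linarith⟩, j, ⟨hj, by linarith⟩, rfl⟩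

theorem neg {f : HahnSeries ℚ ℝ} (hf : LeftFinite f.support) : LeftFinite (-f).support := by
  rwa [HahnSeries.support_neg]

theorem single (q : ℚ) (c : ℝ) : LeftFinite (HahnSeries.single q c).support :=
  (singleton q).mono HahnSeries.support_single_subset

theorem one : LeftFinite (1 : HahnSeries ℚ ℝ).support := single 0 1

theorem pow {f : HahnSeries ℚ ℝ} (hf : LeftFinite f.support) (n : ℕ) :
    LeftFinite (f ^ n).support := by
  induction n with
  | zero => simpa using one
  | succ n ih => rw [pow_succ]; exact ih.mul hf

theorem sum {ι : Type*} (s : Finset ι) (f : ι → HahnSeries ℚ ℝ)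
    (hf : ∀ i, LeftFinite (f i).support) : LeftFinite (∑ i ∈ s, f i).support := by
  classical
  induction s using Finset.induction_on with
  | empty => intro r; simp
  | insert i s hi ih => rw [Finset.sum_insert hi]; exact (hf i).add ih

/-- The inverse of a Hahn series with left-finite support has left-finite support. -/
theorem inv {f : HahnSeries ℚ ℝ} (hf : LeftFinite f.support) : LeftFinite (f⁻¹).support := by
  by_cases hf0 : f = 0
  · subst hf0; rw [inv_zero]; exact hf
  have hc : f.leadingCoeff ≠ 0 := HahnSeries.leadingCoeff_ne_zero.mpr hf0
  set u : HahnSeries ℚ ℝ := HahnSeries.single (-f.order) f.leadingCoeff⁻¹ with hu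
  have hu0 : u ≠ 0 := HahnSeries.single_ne_zero (inv_ne_zero hc)
  set y : HahnSeries ℚ ℝ := 1 - u * f with hy
  have hypos : 0 < y.orderTop :=
    HahnSeries.unit_aux f (inv_mul_cancel₀ hc) _ (neg_add_cancel f.order)
  have hyl : LeftFinite y.support := by
    rw [hy, sub_eq_add_neg]
    exact one.add ((single _ _).mul hf).neg
  have hfz : f⁻¹ = u * (1 - y)⁻¹ := by
    rw [hy, sub_sub_cancel, mul_inv, ← mul_assoc, mul_inv_cancel₀ hu0, one_mul]
  rw [hfz]
  refine (single _ _).mul ?_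
  by_cases hy0 : y = 0
  · rw [hy0, sub_zero, inv_one]; exact one
  have h1y : 1 - y ≠ 0 := by
    rw [hy, sub_sub_cancel]; exact mul_ne_zero hu0 hf0
  have hyo : 0 < y.order := by
    rw [← HahnSeries.order_eq_orderTop_of_ne_zero hy0] at hypos
    exact_mod_cast hypos
  set z := (1 - y)⁻¹ with hz
  have hz0 : z ≠ 0 := inv_ne_zero h1y
  intro r
  obtain ⟨n, hn⟩ := exists_nat_gt ((r - z.order) / y.order)
  have hn : r < n * y.order + z.order := by
    rw [div_lt_iff₀ hyo] at hn; linarith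
  have hgeom : z = ∑ k ∈ Finset.range n, y ^ k + y ^ n * z := by
    have h := mul_neg_geom_sum y n
    have h2 : z * (1 - y) = 1 := inv_mul_cancel₀ h1y
    calc z = z * ((1 - y) * ∑ k ∈ Finset.range n, y ^ k) + y ^ n * z := by rw [h]; ring
      _ = _ := by rw [← mul_assoc, h2, one_mul]
  refine (sum (Finset.range n) (fun k => y ^ k) (fun k => hyl.pow k) r).subset ?_
  rintro q ⟨hq, hqr⟩
  refine ⟨?_, hqr⟩
  have hlow : (y ^ n * z).coeff q = 0 := by
    apply HahnSeries.coeff_eq_zero_of_lt_order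
    rw [HahnSeries.order_mul (pow_ne_zero n hy0) hz0, HahnSeries.order_pow, nsmul_eq_mul]
    linarith
  rw [HahnSeries.mem_support, hgeom, HahnSeries.coeff_add, hlow, add_zero] at hq
  exact hq

end LeftFinite

/-- The Levi-Civita field: functions `ℚ → ℝ` with left-finite support, with pointwise addition and
convolution as multiplication, as a subfield of the lexicographically ordered field of Hahn series
`ℝ((τ^ℚ))`. An element is positive iff its lowest non-zero coefficient is positive. -/
noncomputable def leviCivitaSubfield : Subfield (Lex (HahnSeries ℚ ℝ)) where
  carrier := {f | LeftFinite (ofLex f).support}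
  mul_mem' := fun hf hg => LeftFinite.mul hf hg
  one_mem' := LeftFinite.one
  add_mem' := fun hf hg => LeftFinite.add hf hg
  zero_mem' := fun r => by simp
  neg_mem' := fun hf => LeftFinite.neg hf
  inv_mem' := fun _ hf => LeftFinite.inv hf

/-- The type of elements of the Levi-Civita field. -/
abbrev LeviCivita : Type := leviCivitaSubfield

namespace LeviCivita

/-- The order topology. -/
instance : TopologicalSpace LeviCivita := Preorder.topology LeviCivita

instance : OrderTopology LeviCivita := ⟨rfl⟩

/-- The value of `f : ℚ → ℝ` at `q`, i.e. the coefficient of `τ^q`. -/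
def coeff (f : LeviCivita) (q : ℚ) : ℝ := (ofLex (f : Lex (HahnSeries ℚ ℝ))).coeff q

/-- The element `c τ^q`, i.e. the function with value `c` at `q` and `0` elsewhere. -/
noncomputable def monomial (q : ℚ) (c : ℝ) : LeviCivita :=
  ⟨toLex (HahnSeries.single q c), LeftFinite.single q c⟩

/-- The infinitesimal `τ`. -/
noncomputable def τ : LeviCivita := monomial 1 1

/-- The real number `c` as an element of the Levi-Civita field. -/
noncomputable def const (c : ℝ) : LeviCivita := monomial 0 c

theorem monomial_pos (q : ℚ) {c : ℝ} (hc : 0 < c) : 0 < monomial q c := by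
  change (0 : Lex (HahnSeries ℚ ℝ)) < toLex (HahnSeries.single q c)
  rw [← HahnSeries.leadingCoeff_pos_iff]
  simpa using hc

theorem τ_pos : 0 < τ := monomial_pos 1 one_pos

theorem const_pos {c : ℝ} (hc : 0 < c) : 0 < const c := monomial_pos 0 hc

/-- `f = o(τ^m)`: `f = ∑_{k ≥ m+1} a_k τ^k`, a series in integer powers of `τ` above the
`m`-th. -/
def IsLittleO (f : LeviCivita) (m : ℤ) : Prop :=
  ∀ q : ℚ, f.coeff q ≠ 0 → ∃ k : ℤ, m + 1 ≤ k ∧ q = k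

end LeviCivita

/-- The `CL`-network: the ladder over the Levi-Civita field with series admittance `C τ⁻¹` and shunt
admittance `L⁻¹ τ`. -/
noncomputable def clNetwork (L C : ℝ) (hL : 0 < L) (hC : 0 < C) :
    Network LeviCivita LadderVertex :=
  LadderVertex.ladder (LeviCivita.const C * LeviCivita.τ⁻¹) (LeviCivita.const L⁻¹ * LeviCivita.τ)
    (mul_pos (LeviCivita.const_pos hC) (inv_pos.mpr LeviCivita.τ_pos))
    (mul_pos (LeviCivita.const_pos (inv_pos.mpr hL)) LeviCivita.τ_pos)

/-! Put `s = β / α` and let `u = ladderSeq s`. Off the grounded vertices, harmonicity along `x₀ =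
a₀, x₁, …, x_n` is the recursion `u (k + 2) = (2 + s) u (k + 1) - u k`, read from the grounded end
`x_n` back to `a₀`. So the potential at `x_k` is `u (n - k) / u n`, and `P_eff(Γ_n) = α (1 - u (n -
1) / u n)`. In the difference of two consecutive admittances the numerator is a Casoratian,
constantly `-1`, which leaves exactly `-α / (u n * u (n + 1))`
(`exhaustion_effectiveAdmittance_sub`).

For the `CL`-network `s = τ² / (LC)`, and `u k` is a polynomial in `s` with value `k` at `s = 0`.
Hence `u n * u (n + 1)` is a power series in `τ` with constant term `n (n + 1)`, and the difference
has leading term `-C / (n (n + 1)) τ⁻¹`. Its real coefficient tends to `0`, but each such term is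
infinitely large, so every step exceeds the fixed positive element `τ`. This excludes both
convergence and the Cauchy property. -/

open LadderVertex

/-! ### The three-term recursion of the ladder -/

/-- The solution of `u (k + 2) = (2 + s) u (k + 1) - u k` with `u 0 = 0`, `u 1 = 1`. -/
def ladderSeq {R : Type*} [CommRing R] (s : R) : ℕ → R
  | 0 => 0
  | 1 => 1
  | k + 2 => (2 + s) * ladderSeq s (k + 1) - ladderSeq s k

namespace ladderSeq

section CommRing

variable {R S : Type*} [CommRing R] [CommRing S]

/-- The terms are integer polynomials in `s`. This moves the recursion between the Levi-Civita
field, Hahn series, power series and, through the constant coefficient, the reals. -/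
theorem map (φ : R →+* S) (s : R) (k : ℕ) : φ (ladderSeq s k) = ladderSeq (φ s) k := by
  induction k using Nat.twoStepInduction with
  | zero => simp [ladderSeq]
  | one => simp [ladderSeq]
  | more k h1 h2 => rw [ladderSeq, map_sub, map_mul, map_add, map_ofNat, h1, h2, ladderSeq]

theorem zero_param (k : ℕ) : ladderSeq (0 : R) k = k := by
  induction k using Nat.twoStepInduction with
  | zero => simp [ladderSeq]
  | one => simp [ladderSeq]
  | more k h1 h2 =>
    rw [ladderSeq, h1, h2]
    push_cast
    ring

/-- The Casoratian of the recursion is constant. -/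
theorem casoratian (s : R) (k : ℕ) :
    ladderSeq s k * ladderSeq s (k + 2) - ladderSeq s (k + 1) ^ 2 = -1 := by
  induction k with
  | zero => simp [ladderSeq]
  | succ k ih =>
    have h1 : ladderSeq s (k + 2) = (2 + s) * ladderSeq s (k + 1) - ladderSeq s k := rfl
    have h2 : ladderSeq s (k + 3) = (2 + s) * ladderSeq s (k + 2) - ladderSeq s (k + 1) := rfl
    rw [show k + 1 + 2 = k + 3 from rfl, show k + 1 + 1 = k + 2 from rfl, h2]
    rw [← ih]
    linear_combination (-ladderSeq s (k + 2)) * h1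

end CommRing

theorem pos {K : Type*} [Field K] [LinearOrder K] [IsStrictOrderedRing K] {s : K} (hs : 0 ≤ s)
    {k : ℕ} (hk : k ≠ 0) : 0 < ladderSeq s k := by
  -- Monotonicity is carried along: the next increment is the previous one plus `s * u (j + 1)`.
  have h : ∀ j, 0 ≤ ladderSeq s j ∧ ladderSeq s j < ladderSeq s (j + 1) := by
    intro j
    induction j with
    | zero => simp [ladderSeq]
    | succ j ih =>
      have h0 : 0 < ladderSeq s (j + 1) := ih.1.trans_lt ih.2
      refine ⟨h0.le, ?_⟩
      rw [ladderSeq]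
      nlinarith [mul_nonneg hs h0.le, ih.2]
  obtain ⟨j, rfl⟩ := Nat.exists_eq_succ_of_ne_zero hk
  exact (h j).1.trans_lt (h j).2

end ladderSeq

/-! ### The Dirichlet problem on the finite ladders -/

namespace LadderVertex

/-- The vertices `a₀ = x₀, x₁, x₂, …` along the ladder. -/
def node : ℕ → LadderVertex
  | 0 => a 0
  | k + 1 => x k

/-- The distance of a vertex to `a₀`. -/
def height : LadderVertex → ℕ
  | a 0 => 0
  | a (i + 1) => i + 2
  | x i => i + 1

section Field

variable {K : Type*} [Field K]

theorem admittance_node_succ (α β : K) (k : ℕ) : admittance α β (node k) (node (k + 1)) = α := by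
  cases k <;> simp [node, admittance]

theorem height_le_of_adj {α β : K} {u v : LadderVertex} (h : (ladderGraph α β).Adj u v) :
    height v ≤ height u + 1 := by
  have h : admittance α β u v ≠ 0 := h
  rcases u with (_ | i) | i <;> rcases v with (_ | j) | j <;>
    simp [admittance, height] at h ⊢ <;> omega

theorem height_le_length {α β : K} {u v : LadderVertex} (p : (ladderGraph α β).Walk u v) :
    height v ≤ height u + p.length := by
  induction p with
  | nil => simp
  | cons h p ih =>
    have := height_le_of_adj h
    rw [SimpleGraph.Walk.length_cons]
    omega

/-- Walking along the nodes gives the upper bound; the lower bound holds because `height` grows by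
at most one per edge. -/
theorem dist_eq_height [LinearOrder K] {α β : K} (hα : 0 < α) (hβ : 0 < β) (u : LadderVertex) :
    (ladderGraph α β).dist (a 0) u = height u := by
  have hc := ladderGraph_connected hα hβ
  apply le_antisymm
  · have hx : ∀ i, (ladderGraph α β).dist (a 0) (x i) ≤ i + 1 := by
      intro i
      induction i with
      | zero =>
        exact (SimpleGraph.dist_eq_one_iff_adj.mpr
          (show admittance α β (a 0) (x 0) ≠ 0 by simpa [admittance] using hα.ne')).le
      | succ i ih =>
        have h1 := hc.dist_triangle (u := a 0) (v := x i) (w := x (i + 1))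
        have h2 : (ladderGraph α β).dist (x i) (x (i + 1)) = 1 :=
          SimpleGraph.dist_eq_one_iff_adj.mpr
            (show admittance α β (x i) (x (i + 1)) ≠ 0 by simpa [admittance] using hα.ne')
        omega
    rcases u with (_ | i) | i
    · simp
    · have h1 := hc.dist_triangle (u := a 0) (v := x i) (w := a (i + 1))
      have h2 : (ladderGraph α β).dist (x i) (a (i + 1)) = 1 :=
        SimpleGraph.dist_eq_one_iff_adj.mpr
          (show admittance α β (x i) (a (i + 1)) ≠ 0 by simpa [admittance] using hβ.ne')
      have h3 := hx i
      simp only [height]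
      omega
    · exact hx i
  · obtain ⟨p, hp⟩ := hc.exists_walk_length_eq_dist (a 0) u
    have := height_le_length p
    rw [← hp]
    simpa [height] using this

end Field

variable {K : Type*} [Field K] [LinearOrder K] [IsStrictOrderedRing K] {α β : K}

theorem mem_distBall (hα : 0 < α) (hβ : 0 < β) (n : ℕ) (u : LadderVertex) :
    u ∈ (ladder α β hα hβ).distBall n ↔ height u ≤ n := by
  rw [← dist_eq_height hα hβ]
  rfl

theorem height_node (k : ℕ) : height (node k) = k := by
  cases k <;> rfl

theorem node_mem_distBall (hα : 0 < α) (hβ : 0 < β) {n k : ℕ} (hk : k ≤ n) :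
    node k ∈ (ladder α β hα hβ).distBall n := by
  rwa [mem_distBall, height_node]

/-- The sphere of radius `n` may also contain `a_{n-1}`, but that vertex is grounded already, so
truncation only adds `x_n`. -/
theorem mem_exhaustion_B (hα : 0 < α) (hβ : 0 < β) {n : ℕ} (hn : n ≠ 0)
    (u : (ladder α β hα hβ).distBall n) :
    u ∈ ((ladder α β hα hβ).exhaustion n hn).B ↔
      (∃ i, (u : LadderVertex) = a (i + 1)) ∨ (u : LadderVertex) = node n := by
  have h : u ∈ ((ladder α β hα hβ).exhaustion n hn).B ↔
      (∃ i, (u : LadderVertex) = a (i + 1)) ∨ height u = n := by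
    rw [← dist_eq_height hα hβ]
    rfl
  rw [h]
  rcases u with ⟨(_ | i) | i, hu⟩
  · obtain ⟨m, rfl⟩ := Nat.exists_eq_succ_of_ne_zero hn
    simp [height, node]
  · simp
  · obtain ⟨m, rfl⟩ := Nat.exists_eq_succ_of_ne_zero hn
    simp [height, node]

/-- The Laplacian of a finite ladder at an inner vertex `x_{k+1}`. -/
theorem exhaustion_laplacian_node (hα : 0 < α) (hβ : 0 < β) {n : ℕ} (hn : n ≠ 0)
    (v : (ladder α β hα hβ).distBall n → K) {k : ℕ} (hk : k + 2 ≤ n)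
    (ha : a (k + 1) ∈ (ladder α β hα hβ).distBall n) :
    ((ladder α β hα hβ).exhaustion n hn).laplacian v
        ⟨node (k + 1), node_mem_distBall hα hβ (by omega)⟩ =
      (v ⟨node k, node_mem_distBall hα hβ (by omega)⟩
          - v ⟨node (k + 1), node_mem_distBall hα hβ (by omega)⟩) * α
      + (v ⟨node (k + 2), node_mem_distBall hα hβ hk⟩
          - v ⟨node (k + 1), node_mem_distBall hα hβ (by omega)⟩) * α
      + (v ⟨a (k + 1), ha⟩ - v ⟨node (k + 1), node_mem_distBall hα hβ (by omega)⟩) * β := by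
  classical
  set p : (ladder α β hα hβ).distBall n := ⟨node k, node_mem_distBall hα hβ (by omega)⟩ with hp
  set q : (ladder α β hα hβ).distBall n := ⟨node (k + 1), node_mem_distBall hα hβ (by omega)⟩
    with hq
  set r : (ladder α β hα hβ).distBall n := ⟨node (k + 2), node_mem_distBall hα hβ hk⟩ with hr
  set t : (ladder α β hα hβ).distBall n := ⟨a (k + 1), ha⟩ with ht
  have hpr : p ≠ r := fun h => by
    have := congrArg (fun u : (ladder α β hα hβ).distBall n => height u) h
    simp [hp, hr, height_node] at this
  have hpt : p ≠ t := fun h => by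
    have := congrArg (fun u : (ladder α β hα hβ).distBall n => height u) h
    simp only [hp, ht, height_node] at this
    simp [height] at this
  -- Both vertices have height `k + 2`, so here the constructors must tell them apart.
  have hrt : r ≠ t := fun h => by
    have := congrArg Subtype.val h
    simp [hr, ht, node] at this
  have hρp : admittance α β (node (k + 1)) (node k) = α := by
    rw [admittance_symm, admittance_node_succ]
  have hρt : admittance α β (node (k + 1)) (a (k + 1)) = β := by
    simp [node, admittance]
  have hsum : ((ladder α β hα hβ).exhaustion n hn).laplacian v q =
      ∑ y ∈ ({p, r, t} : Finset ((ladder α β hα hβ).distBall n)),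
        (v y - v q) * admittance α β (node (k + 1)) y := by
    refine finsum_eq_sum_of_support_subset _ fun y hy => ?_
    have hy : admittance α β (node (k + 1)) y ≠ 0 := right_ne_zero_of_mul hy
    obtain ⟨y, hyn⟩ := y
    simp only [Finset.coe_insert, Finset.coe_singleton, Set.mem_insert_iff, Set.mem_singleton_iff,
      hp, hr, ht, Subtype.mk.injEq]
    rcases y with (_ | j) | j <;> rcases k with _ | k <;>
      simp [admittance, node] at hy ⊢ <;> omega
  rw [hsum, Finset.sum_insert (by simp [hpr, hpt]), Finset.sum_insert (by simpa using hrt),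
    Finset.sum_singleton]
  simp only [hp, hr, ht, hρp, hρt, admittance_node_succ, add_assoc]

/-- The potential of the `n`-th finite ladder. -/
def potential (s : K) (n : ℕ) : LadderVertex → K
  | a 0 => 1
  | a (_ + 1) => 0
  | x i => ladderSeq s (n - (i + 1)) / ladderSeq s n

theorem potential_node {s : K} (hs : 0 ≤ s) {n : ℕ} (hn : n ≠ 0) (k : ℕ) :
    potential s n (node k) = ladderSeq s (n - k) / ladderSeq s n := by
  cases k with
  | zero => simp [node, potential, (ladderSeq.pos hs hn).ne']
  | succ k => rfl

theorem isDirichletSolution_potential (hα : 0 < α) (hβ : 0 < β) {n : ℕ} (hn : n ≠ 0) :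
    ((ladder α β hα hβ).exhaustion n hn).IsDirichletSolution
      fun u => potential (β / α) n (u : LadderVertex) := by
  have hs : 0 ≤ β / α := (div_pos hβ hα).le
  refine ⟨fun u hu hu0 => ?_, fun u hu => ?_, rfl⟩
  · rw [mem_exhaustion_B, not_or] at hu
    obtain ⟨u, hun⟩ := u
    rcases u with (_ | i) | k
    · exact absurd rfl hu0
    · exact absurd ⟨i, rfl⟩ hu.1
    · have hkn : k + 1 ≤ n := (mem_distBall hα hβ n _).mp hun
      have hne : k + 1 ≠ n := fun h => hu.2 (congrArg node h)
      have hk : k + 2 ≤ n := by omega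
      -- `a (k + 1)` has height `k + 2`, so the same bound keeps it in the ball: an inner node loses
      -- no neighbour.
      refine (exhaustion_laplacian_node hα hβ hn _ hk ((mem_distBall hα hβ n _).mpr hk)).trans ?_
      simp only [potential_node hs hn]
      obtain ⟨m, rfl⟩ := Nat.exists_eq_add_of_le hk
      have e0 : k + 2 + m - k = m + 2 := by omega
      have e1 : k + 2 + m - (k + 1) = m + 1 := by omega
      have e2 : k + 2 + m - (k + 2) = m := by omega
      have hu0 : ladderSeq (β / α) (k + 2 + m) ≠ 0 := (ladderSeq.pos hs hn).ne'
      rw [e0, e1, e2, ladderSeq, potential]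
      field_simp
      ring
  · rw [mem_exhaustion_B] at hu
    rcases hu with ⟨i, hi⟩ | hu
    · simp only [hi, potential]
    · simp only [hu, potential_node hs hn, Nat.sub_self, ladderSeq, zero_div]

/-- Starting from `0` at `x_n`, the recursion determines all node values up to the single factor
`v(x_{n-1})`, and `v(a₀) = 1` fixes that factor. -/
theorem eq_potential_of_isDirichletSolution (hα : 0 < α) (hβ : 0 < β) {n : ℕ} (hn : n ≠ 0)
    {v : (ladder α β hα hβ).distBall n → K}
    (hv : ((ladder α β hα hβ).exhaustion n hn).IsDirichletSolution v) :
    v = fun u : (ladder α β hα hβ).distBall n => potential (β / α) n (u : LadderVertex) := by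
  have hs : 0 ≤ β / α := (div_pos hβ hα).le
  obtain ⟨hharm, hzero, hone⟩ := hv
  have hrec : ∀ k, (hk : k ≤ n) → v ⟨node (n - k), node_mem_distBall hα hβ (n.sub_le k)⟩ =
      ladderSeq (β / α) k * v ⟨node (n - 1), node_mem_distBall hα hβ (n.sub_le 1)⟩ := by
    intro k
    induction k using Nat.twoStepInduction with
    | zero =>
      intro _
      rw [ladderSeq, zero_mul]
      exact hzero _ ((mem_exhaustion_B hα hβ hn _).mpr (Or.inr rfl))
    | one => intro _; rw [ladderSeq, one_mul]
    | more k h1 h2 =>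
      intro hk
      obtain ⟨j, rfl⟩ := Nat.exists_eq_add_of_le' hk
      have hj : j + 2 ≤ j + (k + 2) := by omega
      have ha : a (j + 1) ∈ (ladder α β hα hβ).distBall (j + (k + 2)) :=
        (mem_distBall hα hβ _ _).mpr hj
      have hlap := hharm ⟨node (j + 1), node_mem_distBall hα hβ (by omega)⟩ (by
          rw [mem_exhaustion_B]
          rintro (⟨i, hi⟩ | h)
          · simp [node] at hi
          · have := congrArg height h
            simp only [height_node] at this
            omega) (fun h => by
          have := congrArg Subtype.val h
          exact absurd this (by rintro ⟨⟩))
      rw [exhaustion_laplacian_node hα hβ hn v hj ha,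
        hzero ⟨a (j + 1), ha⟩ ((mem_exhaustion_B hα hβ hn _).mpr (Or.inl ⟨j, rfl⟩))] at hlap
      have h1 := h1 (by omega)
      have h2 := h2 (by omega)
      simp only [show j + (k + 2) - k = j + 2 by omega,
        show j + (k + 2) - (k + 1) = j + 1 by omega,
        show j + (k + 2) - (k + 2) = j by omega] at h1 h2 ⊢
      rw [h1, h2] at hlap
      rw [ladderSeq]
      apply mul_right_cancel₀ hα.ne'
      have hβα : β / α * α = β := div_mul_cancel₀ β hα.ne'
      linear_combination hlap + ladderSeq (β / α) (k + 1) *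
        v ⟨node (j + (k + 2) - 1), node_mem_distBall hα hβ (Nat.sub_le _ 1)⟩ * (-hβα)
  have hun : ladderSeq (β / α) n ≠ 0 := (ladderSeq.pos hs hn).ne'
  have hc : v ⟨node (n - 1), node_mem_distBall hα hβ (n.sub_le 1)⟩ = (ladderSeq (β / α) n)⁻¹ := by
    -- At `k = n` the node is `a₀`, so this reads `1 = u n * v(x_{n-1})`.
    have h := hrec n le_rfl
    simp only [Nat.sub_self] at h
    rw [eq_comm, inv_eq_iff_eq_inv, eq_comm, inv_eq_iff_eq_inv]
    apply eq_inv_of_mul_eq_one_right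
    rw [← h]
    exact hone
  funext u
  obtain ⟨u, hu⟩ := u
  rcases u with (_ | i) | i
  · exact hone
  · exact hzero _ ((mem_exhaustion_B hα hβ hn _).mpr (Or.inl ⟨i, rfl⟩))
  · have hi : i + 1 ≤ n := (mem_distBall hα hβ n _).mp hu
    have h := hrec (n - (i + 1)) (n.sub_le _)
    simp only [Nat.sub_sub_self hi, hc] at h
    exact h.trans (div_eq_mul_inv _ _).symm

theorem exhaustion_existsUnique_dirichletSolution (hα : 0 < α) (hβ : 0 < β) {n : ℕ} (hn : n ≠ 0) :
    ∃! v, ((ladder α β hα hβ).exhaustion n hn).IsDirichletSolution v :=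
  ⟨_, isDirichletSolution_potential hα hβ hn,
    fun _ hv => eq_potential_of_isDirichletSolution hα hβ hn hv⟩

/-- The only neighbour of `a₀` is `x₁`, and by uniqueness the solution picked by `Classical.epsilon`
is `potential`. -/
theorem exhaustion_effectiveAdmittance (hα : 0 < α) (hβ : 0 < β) (n : ℕ) :
    ((ladder α β hα hβ).exhaustion (n + 1) n.succ_ne_zero).effectiveAdmittance =
      α * (1 - ladderSeq (β / α) n / ladderSeq (β / α) (n + 1)) := by
  have hsol : ((ladder α β hα hβ).exhaustion (n + 1) n.succ_ne_zero).dirichletSolution =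
      fun u : (ladder α β hα hβ).distBall (n + 1) =>
        potential (β / α) (n + 1) (u : LadderVertex) :=
    eq_potential_of_isDirichletSolution hα hβ n.succ_ne_zero
      (Classical.epsilon_spec ⟨_, isDirichletSolution_potential hα hβ n.succ_ne_zero⟩)
  rw [Network.effectiveAdmittance, hsol]
  have hx : x 0 ∈ (ladder α β hα hβ).distBall (n + 1) :=
    (mem_distBall hα hβ _ _).mpr (by simp [height])
  rw [finsum_eq_single _ ⟨x 0, hx⟩]
  · change (1 - potential (β / α) (n + 1) (x 0)) * admittance α β (x 0) (a 0) = _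
    simp [potential, admittance, mul_comm]
  · rintro ⟨y, hy⟩ hne
    change _ * admittance α β y (a 0) = 0
    rcases y with i | (_ | i)
    · simp [admittance]
    · exact absurd rfl hne
    · simp [admittance]

/-- Over a common denominator the numerator is the Casoratian. -/
theorem exhaustion_effectiveAdmittance_sub (hα : 0 < α) (hβ : 0 < β) {n : ℕ} (hn : n ≠ 0) :
    ((ladder α β hα hβ).exhaustion (n + 1) n.succ_ne_zero).effectiveAdmittance
        - ((ladder α β hα hβ).exhaustion n hn).effectiveAdmittance =
      -(α * (ladderSeq (β / α) n * ladderSeq (β / α) (n + 1))⁻¹) := by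
  obtain ⟨m, rfl⟩ := Nat.exists_eq_succ_of_ne_zero hn
  have hs : 0 ≤ β / α := (div_pos hβ hα).le
  rw [exhaustion_effectiveAdmittance, exhaustion_effectiveAdmittance]
  have h1 : ladderSeq (β / α) (m + 1) ≠ 0 := (ladderSeq.pos hs (by omega)).ne'
  have h2 : ladderSeq (β / α) (m + 1 + 1) ≠ 0 := (ladderSeq.pos hs (by omega)).ne'
  have h := ladderSeq.casoratian (β / α) m
  generalize β / α = s at *
  rw [Nat.succ_eq_add_one]
  field_simp
  linear_combination h

end LadderVertex

/-! ### Leading terms in the Levi-Civita field -/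

namespace LeviCivita

/-- The inclusion of the Levi-Civita field into the field of Hahn series. -/
def toHahnSeries : LeviCivita →+* HahnSeries ℚ ℝ where
  toFun f := ofLex (f : Lex (HahnSeries ℚ ℝ))
  map_one' := rfl
  map_mul' _ _ := rfl
  map_zero' := rfl
  map_add' _ _ := rfl

theorem coeff_eq (f : LeviCivita) (q : ℚ) : f.coeff q = (toHahnSeries f).coeff q := rfl

theorem toHahnSeries_const (c : ℝ) : toHahnSeries (const c) = HahnSeries.C c := rfl

theorem toHahnSeries_τ : toHahnSeries τ = HahnSeries.single 1 1 := rfl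

theorem lt_of_coeff {f g : LeviCivita} (q : ℚ) (h : ∀ r < q, f.coeff r = g.coeff r)
    (hq : f.coeff q < g.coeff q) : f < g :=
  (HahnSeries.lt_iff _ _).mpr ⟨q, h, hq⟩

/-- A power series in `τ` is `o(τ⁻¹)`. -/
theorem isLittleO_of_ofPowerSeries {f : LeviCivita} {Q : PowerSeries ℝ}
    (h : toHahnSeries f = HahnSeries.ofPowerSeries ℚ ℝ Q) : f.IsLittleO (-1) := by
  intro q hq
  rw [coeff_eq, h, HahnSeries.ofPowerSeries_apply] at hq
  obtain ⟨k, -, rfl⟩ := HahnSeries.support_embDomain_subset hq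
  exact ⟨k, by omega, by simp⟩

theorem IsLittleO.coeff_eq_zero {f : LeviCivita} {m : ℤ} (hf : f.IsLittleO m) {q : ℚ}
    (hq : q ≤ m) : f.coeff q = 0 := by
  by_contra h
  obtain ⟨k, hk, rfl⟩ := hf q h
  have : k ≤ m := by exact_mod_cast hq
  omega

theorem const_mul_inv_τ_eq (c : ℝ) : const c * τ⁻¹ = monomial (-1) c := by
  rw [mul_inv_eq_iff_eq_mul₀ τ_pos.ne']
  have h : (HahnSeries.single 0 c : HahnSeries ℚ ℝ) =
      HahnSeries.single (-1) c * HahnSeries.single 1 1 := by simp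
  exact Subtype.ext h

theorem coeff_monomial_self (q : ℚ) (c : ℝ) : (monomial q c).coeff q = c :=
  HahnSeries.coeff_single_same q c

theorem coeff_monomial_of_ne {q r : ℚ} (h : r ≠ q) (c : ℝ) : (monomial q c).coeff r = 0 :=
  HahnSeries.coeff_single_of_ne h

/-- An element with negative leading term of order `τ⁻¹` exceeds `τ` in absolute value. -/
theorem τ_lt_abs_of_isLittleO {f : LeviCivita} {c : ℝ} (hc : c < 0)
    (hf : (f - const c * τ⁻¹).IsLittleO (-1)) : τ < |f| := by
  refine lt_of_lt_of_le ?_ (neg_le_abs f)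
  -- Up to exponent `-1`, `f` agrees with its leading monomial, while `τ` vanishes there; the
  -- lexicographic order is thus decided at `-1`.
  have hcoeff : ∀ q ≤ (-1 : ℚ), f.coeff q = (monomial (-1) c).coeff q := fun q hq => by
    have h := hf.coeff_eq_zero (q := q) (by simpa using hq)
    rw [const_mul_inv_τ_eq, coeff_eq, map_sub, HahnSeries.coeff_sub, sub_eq_zero] at h
    exact h
  have hneg : ∀ q, (-f).coeff q = -f.coeff q := fun q => by
    rw [coeff_eq, map_neg, HahnSeries.coeff_neg, coeff_eq]
  have hτ : ∀ q ≤ (-1 : ℚ), τ.coeff q = 0 := fun q hq =>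
    coeff_monomial_of_ne (by linarith) 1
  refine lt_of_coeff (-1) (fun r hr => ?_) ?_
  · rw [hτ r hr.le, hneg, hcoeff r hr.le, coeff_monomial_of_ne hr.ne, neg_zero]
  · rw [hτ _ le_rfl, hneg, hcoeff _ le_rfl, coeff_monomial_self]
    linarith

end LeviCivita

/-! ### The `CL`-network -/

open LeviCivita in
-- The computation is done in real power series in `τ`, where a nonzero constant term makes `u n * u
-- (n + 1)` invertible, and then transported to Hahn series by `ofPowerSeries`.
theorem clNetwork_effectiveAdmittance_sub_isLittleO (L C : ℝ) (hL : 0 < L) (hC : 0 < C) {n : ℕ}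
    (hn : n ≠ 0) :
    IsLittleO (((clNetwork L C hL hC).exhaustion (n + 1) n.succ_ne_zero).effectiveAdmittance
        - ((clNetwork L C hL hC).exhaustion n hn).effectiveAdmittance
        - const (-C / ((n : ℝ) * (n + 1))) * τ⁻¹) (-1) := by
  -- `S` is `β / α = τ² / (LC)`, with `X` in the role of `τ`.
  obtain ⟨S, hS⟩ : ∃ S : PowerSeries ℝ, S = PowerSeries.C (L⁻¹ * C⁻¹) * PowerSeries.X ^ 2 :=
    ⟨_, rfl⟩
  obtain ⟨W, hW⟩ : ∃ W : PowerSeries ℝ, W = ladderSeq S n * ladderSeq S (n + 1) := ⟨_, rfl⟩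
  have hn' : (n : ℝ) * (n + 1) ≠ 0 := by positivity
  have hW0 : PowerSeries.constantCoeff W = (n : ℝ) * (n + 1) := by
    rw [hW, map_mul, ladderSeq.map, ladderSeq.map]
    simp [hS, ladderSeq.zero_param]
  have hWW : W * W⁻¹ = 1 := PowerSeries.mul_inv_cancel W (hW0 ▸ hn')
  -- The constant terms cancel; the factor `X` gained absorbs the `τ⁻¹` of `α`, so the quotient `Q`
  -- is the remainder itself.
  have hX : PowerSeries.X ∣
      PowerSeries.C (C / ((n : ℝ) * (n + 1))) - PowerSeries.C C * W⁻¹ := by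
    rw [PowerSeries.X_dvd_iff]
    simp [hW0, div_eq_mul_inv]
  obtain ⟨Q, hQ⟩ := hX
  apply isLittleO_of_ofPowerSeries (Q := Q)
  rw [clNetwork, exhaustion_effectiveAdmittance_sub]
  set T : HahnSeries ℚ ℝ := HahnSeries.single 1 1 with hT
  have hT0 : T ≠ 0 := HahnSeries.single_ne_zero one_ne_zero
  set ι := HahnSeries.ofPowerSeries ℚ ℝ
  have hιX : ι PowerSeries.X = T := HahnSeries.ofPowerSeries_X
  have hιC : ∀ c : ℝ, ι (PowerSeries.C c) = HahnSeries.C c := fun c => HahnSeries.ofPowerSeries_C c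
  have hCinv : ∀ c : ℝ, (HahnSeries.C c⁻¹ : HahnSeries ℚ ℝ) = (HahnSeries.C c)⁻¹ := fun c =>
    map_inv₀ HahnSeries.C c
  have hC0 : (HahnSeries.C C : HahnSeries ℚ ℝ) ≠ 0 := HahnSeries.C_ne_zero hC.ne'
  have hs : toHahnSeries (const L⁻¹ * τ / (const C * τ⁻¹)) = ι S := by
    rw [hS, map_div₀, map_mul, map_mul, map_inv₀, toHahnSeries_const, toHahnSeries_const,
      toHahnSeries_τ, map_mul, map_pow, hιX, hιC, map_mul, hCinv C, ← hT]
    field_simp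
  have hιW : ι W⁻¹ = (ι W)⁻¹ := by
    apply eq_inv_of_mul_eq_one_right
    rw [← map_mul, hWW, map_one]
  have hQ' := congrArg ι hQ
  rw [map_sub, map_mul, map_mul, hιC, hιC, hιX, hιW] at hQ'
  have hUV : toHahnSeries (ladderSeq (const L⁻¹ * τ / (const C * τ⁻¹)) n *
      ladderSeq (const L⁻¹ * τ / (const C * τ⁻¹)) (n + 1)) = ι W := by
    rw [map_mul, ladderSeq.map, ladderSeq.map, hs, hW, map_mul, ladderSeq.map, ladderSeq.map]
  rw [map_sub, map_neg, map_mul, map_inv₀, hUV, map_mul, map_inv₀, toHahnSeries_const, map_mul,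
    map_inv₀, toHahnSeries_const, toHahnSeries_τ, neg_div, map_neg, ← hT]
  apply mul_left_cancel₀ hT0
  rw [← hQ']
  have hTT : T * T⁻¹ = 1 := mul_inv_cancel₀ hT0
  linear_combination (HahnSeries.C (C / ((n : ℝ) * (n + 1))) - HahnSeries.C C * (ι W)⁻¹) * hTT

open LeviCivita in
theorem clNetwork_τ_lt_abs_effectiveAdmittance_sub (L C : ℝ) (hL : 0 < L) (hC : 0 < C) {n : ℕ}
    (hn : n ≠ 0) :
    τ < |((clNetwork L C hL hC).exhaustion (n + 1) n.succ_ne_zero).effectiveAdmittance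
        - ((clNetwork L C hL hC).exhaustion n hn).effectiveAdmittance| :=
  τ_lt_abs_of_isLittleO (div_neg_of_neg_of_pos (neg_neg_of_pos hC) (by positivity))
    (clNetwork_effectiveAdmittance_sub_isLittleO L C hL hC hn)

/-- A sequence whose consecutive differences stay away from `0` is not Cauchy. -/
theorem not_isCauSeq_of_lt_abs_sub {K : Type*} [Field K] [LinearOrder K] [IsStrictOrderedRing K]
    {f : ℕ → K} {ε : K} (hε : 0 < ε) (h : ∀ n, ε < |f (n + 1) - f n|) :
    ¬ IsCauSeq (fun t : K => |t|) f := fun hf => by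
  obtain ⟨N, hN⟩ := hf ε hε
  exact (h N).not_gt (hN (N + 1) N.le_succ)

/-- A sequence whose consecutive differences stay away from `0` does not converge. -/
theorem not_tendsto_of_lt_abs_sub {K : Type*} [Field K] [LinearOrder K] [IsStrictOrderedRing K]
    [TopologicalSpace K] [OrderTopology K] {f : ℕ → K} {ε : K} (hε : 0 < ε)
    (h : ∀ n, ε < |f (n + 1) - f n|) : ¬ ∃ p, Filter.Tendsto f Filter.atTop (nhds p) := by
  rintro ⟨p, hp⟩
  obtain ⟨N, hN⟩ := Filter.eventually_atTop.mp
    (LinearOrderedAddCommGroup.tendsto_nhds.mp hp (ε / 2) (half_pos hε))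
  have h1 := hN N le_rfl
  have h2 := hN (N + 1) N.le_succ
  have h3 := abs_sub_le (f (N + 1)) p (f N)
  rw [abs_sub_comm p (f N)] at h3
  linarith [h N]

theorem mainTheorem10 (L C : ℝ) (hL : 0 < L) (hC : 0 < C) :
    -- each finite network has a well-defined effective admittance
    (∀ (n : ℕ) (hn : n ≠ 0),
      ∃! v, ((clNetwork L C hL hC).exhaustion n hn).IsDirichletSolution v) ∧
    -- the sequence `P_eff(Γ_1), P_eff(Γ_2), …` has no limit in the order topology
    (¬ ∃ p : LeviCivita, Filter.Tendsto
      (fun n : ℕ =>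
        ((clNetwork L C hL hC).exhaustion (n + 1) n.succ_ne_zero).effectiveAdmittance)
      Filter.atTop (nhds p)) ∧
    -- the leading term of consecutive differences, of order `τ⁻¹`
    (∀ (n : ℕ) (hn : n ≠ 0), LeviCivita.IsLittleO
      (((clNetwork L C hL hC).exhaustion (n + 1) n.succ_ne_zero).effectiveAdmittance
        - ((clNetwork L C hL hC).exhaustion n hn).effectiveAdmittance
        - LeviCivita.const (-C / ((n : ℝ) * (n + 1))) * LeviCivita.τ⁻¹) (-1)) ∧
    (∀ (n : ℕ) (hn : n ≠ 0), LeviCivita.τ <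
      |((clNetwork L C hL hC).exhaustion (n + 1) n.succ_ne_zero).effectiveAdmittance
        - ((clNetwork L C hL hC).exhaustion n hn).effectiveAdmittance|) ∧
    -- the sequence is not Cauchy
    ¬ IsCauSeq (fun t : LeviCivita => |t|) (fun n : ℕ =>
      ((clNetwork L C hL hC).exhaustion (n + 1) n.succ_ne_zero).effectiveAdmittance) :=
  ⟨fun _ hn => LadderVertex.exhaustion_existsUnique_dirichletSolution _ _ hn,
    -- Index `n` stands for `Γ_{n+1}`, hence the bound is taken at the successor.
    not_tendsto_of_lt_abs_sub LeviCivita.τ_pos fun n =>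
      clNetwork_τ_lt_abs_effectiveAdmittance_sub L C hL hC n.succ_ne_zero,
    fun _ hn => clNetwork_effectiveAdmittance_sub_isLittleO L C hL hC hn,
    fun _ hn => clNetwork_τ_lt_abs_effectiveAdmittance_sub L C hL hC hn,
    not_isCauSeq_of_lt_abs_sub LeviCivita.τ_pos fun n =>
      clNetwork_τ_lt_abs_effectiveAdmittance_sub L C hL hC n.succ_ne_zero⟩
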